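/- For $d\ge 1$ let $\Pi^*$ be a probability distribution on $\mathbb R^d$ with density $\pi^*\propto e^{-f}$. Call $\Pi^*$ *$(L,L_H,s,\psi_{\mathfrak a},M)$-regular with set $\Omega$*, where $L,\psi_{\mathfrak a}>0$, $L_H,M\ge 0$ and $\mathfrak a\in\{0,\tfrac12\}$, if $f$ is twice differentiable, $\nabla f$ is $L$-Lipschitz, $\nabla^2 f$ is $L_H$-Lipschitz (in $\ell_2$-operator norm), and $\Omega\subset\mathbb R^d$ is a convex measurable set such that $\Pi^*(\Omega)\ge 1-s$, $\|\nabla f(x)\|_2\le M$ for all $x\in\Omega$, and the normalized restriction $\Pi^*_\Omega$ of $\Pi^*$ to $\Omega$ satisfies, for every measurable partition $S_1,S_2,S_3$ of $\Omega$ and with $m=\min\{\Pi^*_\Omega(S_1),\Pi^*_\Omega(S_2)\}$, $$\Pi^*_\Omega(S_3)\ \ge\ \frac{1}{2\psi_{\mathfrak a}}\cdot \inf_{x\in S_1,\,y\in S_2}\|x-y\|_2\cdot m\cdot\log^{\mathfrak a}\Big(1+\frac1m\Big),$$ the right-hand side being read as $0$ when $m=0$. For an integer $K\ge1$ and a step size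 $\eta>0$, start from $(p_0,q_0)$ and for $k=0,\dots,K-1$ put $p_{k+1/2}=p_k-\frac\eta2\nabla f(q_k)$, $q_{k+1}=q_k+\eta\,p_{k+1/2}$, $p_{k+1}=p_{k+1/2}-\frac\eta2\nabla f(q_{k+1})$ (leapfrog integrator). Let $\mathcal P_x$ (the HMC proposal at $x$) be the law of $q_K$ when $q_0=x$ and $p_0\sim\mathcal N(0,\mathbb I_d)$, and let $\mathcal T^{\text{before-lazy}}_x$ be the law of the state that equals $q_K$ with probability $\min\{1,e^{-\mathcal H(p_K,q_K)}/e^{-\mathcal H(p_0,q_0)}\}$ and equals $x$ otherwise, where $\mathcal H(p,q)=f(q)+\frac12\|p\|_2^2$. Let $d_{\rm TV}(P,Q)=\sup_A|P(A)-Q(A)|$. There is a universal constant $c>0$ such that the following holds for every $d\ge1$, every $(L,L_H,s,\psi_{\mathfrak a},M)$-regular $\Pi^*$ with set $\Omega$, and every $K\ge 1$, $\eta>0$ with $$K\eta\le\frac1{4L}\qquad\text{and}\qquad K^2\eta^2\le\frac{1}{4\max\{d^{1/2}L,\ d^{2/3}L_H^{2/3}\}}.$$ First, $$\sup_{\|q_0-\tilde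 q_0\|_2\le K\eta/4} d_{\rm TV}\big(\mathcal P_{q_0},\mathcal P_{\tilde q_0}\big)\le\frac12 .$$ If, in addition, $$\eta^2\le\frac1{cL}\min\left\{\frac1{K^2},\ \frac1{Kd^{1/2}},\ \frac1{K^{2/3}d^{1/3}\big(\frac{M^2}{L}\big)^{1/3}},\ \frac1{K\frac{M}{L^{1/2}}},\ \frac1{K^{2/3}d}\frac{L}{L_H^{2/3}},\ \frac1{K^{4/3}\frac{M}{L^{1/2}}}\Big(\frac{L}{L_H^{2/3}}\Big)^{1/2}\right\}$$ (terms with a vanishing denominator being $+\infty$), then $$\sup_{x\in\Omega} d_{\rm TV}\big(\mathcal P_x,\mathcal T^{\text{before-lazy}}_x\big)\le\frac18 .$$ -/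

import Mathlib

open MeasureTheory ProbabilityTheory
open scoped ENNReal Gradient

noncomputable section

namespace HMC

/-- The state space `ℝ^d` with its Euclidean norm. -/
abbrev State (d : ℕ) : Type := EuclideanSpace ℝ (Fin d)

/-! ### Regularity of the potential -/

/-- `f` is `L`-smooth: it is differentiable and its gradient is `L`-Lipschitz. -/
def IsSmoothWith {d : ℕ} (f : State d → ℝ) (L : ℝ) : Prop :=
  Differentiable ℝ f ∧ ∀ x y : State d, ‖∇ f x - ∇ f y‖ ≤ L * ‖x - y‖

/-- The Hessian of `f` at `x`, as a continuous linear operator (normed by the operator norm). -/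
def hessian {d : ℕ} (f : State d → ℝ) (x : State d) : State d →L[ℝ] State d :=
  fderiv ℝ (∇ f) x

/-- `f` is twice differentiable and its Hessian is `LH`-Lipschitz in operator norm. -/
def IsHessianLipschitz {d : ℕ} (f : State d → ℝ) (LH : ℝ) : Prop :=
  Differentiable ℝ f ∧ Differentiable ℝ (∇ f) ∧
    ∀ x y : State d, ‖hessian f x - hessian f y‖ ≤ LH * ‖x - y‖

/-! ### The target distribution -/

/-- The distribution on `ℝ^d` with density proportional to `exp (-f)`. -/
def target {d : ℕ} (f : State d → ℝ) : Measure (State d) :=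
  (∫⁻ x : State d, ENNReal.ofReal (Real.exp (-f x)))⁻¹ •
    (volume : Measure (State d)).withDensity fun x => ENNReal.ofReal (Real.exp (-f x))

/-- `inf {‖x - y‖ : x ∈ S, y ∈ T}`. -/
def setDist {d : ℕ} (S T : Set (State d)) : ℝ :=
  sInf {r : ℝ | ∃ x ∈ S, ∃ y ∈ T, r = ‖x - y‖}

/-- The inequality
`P(S₃) ≥ (2ψ)⁻¹ d(S₁, S₂) m log^a (1 + 1/m)` with `m = min {P(S₁), P(S₂)}`, for all measurable
partitions `S₁, S₂, S₃` of `X`.  It is the isoperimetric inequality for `a = 0` and the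
log-isoperimetric inequality for `a = 1/2`. -/
def IsIsoperimetric {d : ℕ} (P : Measure (State d)) (X : Set (State d)) (a ψ : ℝ) : Prop :=
  ∀ S₁ S₂ S₃ : Set (State d),
    MeasurableSet S₁ → MeasurableSet S₂ → MeasurableSet S₃ →
    Disjoint S₁ S₂ → Disjoint S₁ S₃ → Disjoint S₂ S₃ → S₁ ∪ S₂ ∪ S₃ = X →
    1 / (2 * ψ) * setDist S₁ S₂ * min (P.real S₁) (P.real S₂) *
      Real.log (1 + 1 / min (P.real S₁) (P.real S₂)) ^ a ≤ P.real S₃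

/-- The distribution with density proportional to `exp (-f)` is
`(L, LH, s, ψ, M)`-regular (isoperimetric for `a = 0`, log-isoperimetric for `a = 1/2`),
with `Ω` as the convex measurable set of large mass and bounded gradient.  Here `cond P Ω` is the
restriction of `P` to `Ω`, normalized. -/
structure IsRegularOn {d : ℕ} (f : State d → ℝ) (L LH s a ψ M : ℝ) (Ω : Set (State d)) :
    Prop where
  integrable : Integrable fun x : State d => Real.exp (-f x)
  smooth : IsSmoothWith f L
  hessianLipschitz : IsHessianLipschitz f LH
  convex : Convex ℝ Ω
  measurableSet : MeasurableSet Ω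
  isoperimetric : IsIsoperimetric (cond (target f) Ω) Ω a ψ
  mass : 1 - s ≤ (target f).real Ω
  gradient_le : ∀ x ∈ Ω, ‖∇ f x‖ ≤ M

/-! ### Metropolized Hamiltonian Monte Carlo -/

/-- The Hamiltonian `f(q) + ‖p‖² / 2` of a pair `(p, q)` of momentum and position. -/
def hamiltonian {d : ℕ} (f : State d → ℝ) (z : State d × State d) : ℝ :=
  f z.2 + ‖z.1‖ ^ 2 / 2

/-- One leapfrog update of the pair `(p, q)` with step size `η`. -/
def leapfrog {d : ℕ} (f : State d → ℝ) (η : ℝ) (z : State d × State d) : State d × State d :=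
  let pHalf := z.1 - (η / 2) • ∇ f z.2
  let q := z.2 + η • pHalf
  (pHalf - (η / 2) • ∇ f q, q)

/-- The pair `(p_K, q_K)` obtained from `(p₀, q₀) = (p, x)` by `K` leapfrog updates. -/
def endState {d : ℕ} (f : State d → ℝ) (K : ℕ) (η : ℝ) (x p : State d) : State d × State d :=
  (leapfrog f η)^[K] (p, x)

/-- The proposal distribution at `x`: the law of `q_K` for `q₀ = x` and `p₀ ∼ N(0, I)`. -/
def proposal {d : ℕ} (f : State d → ℝ) (K : ℕ) (η : ℝ) (x : State d) : Measure (State d) :=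
  (stdGaussian (State d)).map fun p => (endState f K η x p).2

/-- The Metropolis acceptance probability `min {1, exp (-H(p_K, q_K)) / exp (-H(p₀, q₀))}` for
`(p₀, q₀) = (p, x)`. -/
def acceptProb {d : ℕ} (f : State d → ℝ) (K : ℕ) (η : ℝ) (x p : State d) : ℝ :=
  min 1 (Real.exp (-hamiltonian f (endState f K η x p)) / Real.exp (-hamiltonian f (p, x)))

/-- The transition distribution at `x` after the proposal and the accept-reject step, before the
lazy step: the chain moves to `q_K` if the proposal is accepted and stays at `x` otherwise. -/
def transitionBeforeLazy {d : ℕ} (f : State d → ℝ) (K : ℕ) (η : ℝ) (x : State d) :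
    Measure (State d) :=
  ((stdGaussian (State d)).withDensity fun p => ENNReal.ofReal (acceptProb f K η x p)).map
      (fun p => (endState f K η x p).2) +
    (∫⁻ p, ENNReal.ofReal (1 - acceptProb f K η x p) ∂stdGaussian (State d)) • Measure.dirac x

/-- Total variation distance `sup_A |P(A) - Q(A)|` of two probability measures. -/
def tvDist {α : Type*} [MeasurableSpace α] (P Q : Measure α) : ℝ :=
  sSup {r : ℝ | ∃ A : Set α, MeasurableSet A ∧ r = |P.real A - Q.real A|}

/-- The upper bound on `η²` in the step-size condition for the accept-reject step.  It lives in
`[0, ∞]` because a term is `+∞` when its denominator vanishes (`LH = 0` or `M = 0`). -/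
def stepThreshold (c L LH M d K : ℝ≥0∞) : ℝ≥0∞ :=
  1 / (c * L) *
    min (1 / K ^ 2)
    (min (1 / (K * d ^ (1 / 2 : ℝ)))
    (min (1 / (K ^ (2 / 3 : ℝ) * d ^ (1 / 3 : ℝ) * (M ^ 2 / L) ^ (1 / 3 : ℝ)))
    (min (1 / (K * (M / L ^ (1 / 2 : ℝ))))
    (min (1 / (K ^ (2 / 3 : ℝ) * d) * (L / LH ^ (2 / 3 : ℝ)))
      (1 / (K ^ (4 / 3 : ℝ) * (M / L ^ (1 / 2 : ℝ))) * (L / LH ^ (2 / 3 : ℝ)) ^ (1 / 2 : ℝ))))))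

end HMC

end

/-!
Everything is elementary once the leapfrog trajectory is written as free flight `q + T p` plus a
perturbation, where `T = K η` is the total time and the step-size conditions give `L T² ≤ 1/4`
and `d LH T³ ≤ 1/8`.  Differences, and differences of differences, of trajectories obey the same
recursion with another force, so that one discrete Grönwall bound (`IsLeapfrog.norm_pos_le`)
serves for all comparisons of trajectories.

*Overlap of the proposals.*  For a short time the end position is a bijective function of the
initial momentum (`exists_momentum` gives surjectivity, which is all that is needed), so there is a
map `φ` on momenta with `q_K(q', φ p) = q_K(q, p)`, and the two proposals are the images under one
map of the law of `φ p` and of the Gaussian law itself.  The map `φ` is nearly a translation: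
`φ p - p` has norm at most `1/3` and Lipschitz constant of order `LH T³`, hence `O(1/d)`.  The
density ratio of the two laws consists of a Gaussian factor and a Jacobian factor.  The Jacobian
needs no determinant and no differentiability of `φ`: preimages under an antilipschitz map have
Hausdorff measure at most the `d`-th power of its constant times that of the set
(`AntilipschitzWith.volume_preimage_le`).  The Gaussian factor is `exp (-u)` with `u` close to
`⟪φ 0, p⟫ + ‖φ 0‖² / 2`, and `1 - exp (-u) ≤ max u 0` is integrated using second moments only
(`stdGaussian_preimage_sub_le`).

*Acceptance.*  One leapfrog update changes the energy by `η² / 8 * (‖∇ f q'‖² - ‖∇ f q‖²)` plus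
the error of the trapezoidal rule for `f` along the step, which is at most `LH ‖q' - q‖³ / 2`
(`hamiltonian_leapfrog_sub_le`).  The first part telescopes over the trajectory; together with the
bounds on positions and momenta this controls the total energy error by six monomials, which are
those of the step-size threshold (`stepThreshold_bounds`, `energy_error_le`).  Momenta with
`‖p‖² ≥ 16 d` have probability at most `1/16` by Markov's inequality, and for the others the energy
error is at most `1/16` (`tvDist_proposal_transition_le`).
-/

namespace HMC

open scoped RealInnerProductSpace NNReal

/-! ### Growth of leapfrog recursions -/

/-- Positions `x`, half-step momenta `v` and forces `a` that obey the leapfrog recursion with step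
size `η` and initial momentum `y`.  The force is an arbitrary sequence, so that differences of
such recursions are again such recursions. -/
structure IsLeapfrog {E : Type*} [NormedAddCommGroup E] [NormedSpace ℝ E]
    (η : ℝ) (x v a : ℕ → E) (y : E) : Prop where
  pos : ∀ k, x (k + 1) = x k + η • v k
  init : v 0 = y - (η / 2) • a 0
  mom : ∀ k, v (k + 1) = v k - η • a (k + 1)

namespace IsLeapfrog

variable {E : Type*} [NormedAddCommGroup E] [NormedSpace ℝ E] {η : ℝ} {x v a x' v' a' : ℕ → E}
  {y y' : E}

theorem sub (h : IsLeapfrog η x v a y) (h' : IsLeapfrog η x' v' a' y') :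
    IsLeapfrog η (fun k => x k - x' k) (fun k => v k - v' k) (fun k => a k - a' k) (y - y') where
  pos k := by simp only [h.pos, h'.pos]; module
  init := by simp only [h.init, h'.init]; module
  mom k := by simp only [h.mom, h'.mom]; module

theorem sub_const (h : IsLeapfrog η x v a y) (c : E) :
    IsLeapfrog η (fun k => x k - c) v a y where
  pos k := by simp only [h.pos]; module
  init := h.init
  mom := h.mom

theorem norm_mom_sub_le (h : IsLeapfrog η x v a y) (hη : 0 ≤ η) {A : ℝ} {N : ℕ}
    (ha : ∀ j < N, ‖a j‖ ≤ A) : ∀ k < N, ‖v k - y‖ ≤ (k + 1 / 2) * η * A := by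
  intro k
  induction k with
  | zero =>
    intro hk
    have e : v 0 - y = -((η / 2) • a 0) := by rw [h.init]; module
    rw [e, norm_neg, norm_smul, Real.norm_of_nonneg (by positivity)]
    have := mul_le_mul_of_nonneg_left (ha 0 hk) (by positivity : 0 ≤ η / 2)
    push_cast
    linarith
  | succ k ih =>
    intro hk
    have e : v (k + 1) - y = (v k - y) - η • a (k + 1) := by rw [h.mom]; module
    have h1 := norm_sub_le (v k - y) (η • a (k + 1))
    rw [norm_smul, Real.norm_of_nonneg hη] at h1
    have h2 := mul_le_mul_of_nonneg_left (ha (k + 1) hk) hη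
    have h3 := ih (by omega)
    rw [e]
    push_cast
    linarith

theorem norm_pos_sub_le (h : IsLeapfrog η x v a y) (hη : 0 ≤ η) {A : ℝ} {N : ℕ}
    (ha : ∀ j < N, ‖a j‖ ≤ A) :
    ∀ k ≤ N, ‖x k - x 0 - (k * η) • y‖ ≤ (k * η) ^ 2 / 2 * A := by
  intro k
  induction k with
  | zero => intro _; simp
  | succ k ih =>
    intro hk
    have e : x (k + 1) - x 0 - (((k + 1 : ℕ) : ℝ) * η) • y
        = (x k - x 0 - (k * η) • y) + η • (v k - y) := by
      rw [h.pos]; push_cast; module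
    have h1 := norm_add_le (x k - x 0 - (k * η) • y) (η • (v k - y))
    rw [norm_smul, Real.norm_of_nonneg hη] at h1
    have h2 := mul_le_mul_of_nonneg_left (h.norm_mom_sub_le hη ha k (by omega)) hη
    have h3 := ih (by omega)
    rw [e]
    push_cast
    linarith

/-- Discrete Grönwall bound: if the force is bounded by `l ‖x‖ + b` and the total time `T = N η` is
short, `l T² ≤ 1/4`, then the positions stay within a multiple of the bound
`‖x₀‖ + T ‖y‖ + T² b / 2` that would hold for `l = 0`. -/
theorem norm_pos_le (h : IsLeapfrog η x v a y) (hη : 0 ≤ η) {l b T : ℝ} {N : ℕ}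
    (hT : T = N * η) (hl : 0 ≤ l) (hb : 0 ≤ b) (hlT : l * T ^ 2 ≤ 1 / 4)
    (ha : ∀ j < N, ‖a j‖ ≤ l * ‖x j‖ + b) :
    ∀ k ≤ N, ‖x k‖ ≤ 8 / 7 * (‖x 0‖ + T * ‖y‖ + T ^ 2 / 2 * b) := by
  have hT0 : 0 ≤ T := by rw [hT]; positivity
  set B := 8 / 7 * (‖x 0‖ + T * ‖y‖ + T ^ 2 / 2 * b) with hB
  have hB0 : 0 ≤ B := by positivity
  intro k
  induction k using Nat.strong_induction_on with
  | _ k ih =>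
    intro hk
    have hA : ∀ j < k, ‖a j‖ ≤ l * B + b := fun j hj =>
      (ha j (by omega)).trans (by gcongr; exact ih j hj (by omega))
    have h1 := h.norm_pos_sub_le hη hA k le_rfl
    have hkT : k * η ≤ T := by rw [hT]; gcongr
    have hk0 : 0 ≤ k * η := by positivity
    have h2 : (k * η) ^ 2 / 2 * (l * B + b) ≤ T ^ 2 / 2 * (l * B + b) := by gcongr
    have h3 : ‖x k‖ ≤ ‖x k - x 0 - (k * η) • y‖ + (‖x 0‖ + ‖(k * η) • y‖) := by
      calc ‖x k‖ = ‖(x k - x 0 - (k * η) • y) + (x 0 + (k * η) • y)‖ := by congr 1; module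
        _ ≤ _ := (norm_add_le _ _).trans (by gcongr; exact norm_add_le _ _)
    rw [norm_smul, Real.norm_of_nonneg hk0] at h3
    have h4 : k * η * ‖y‖ ≤ T * ‖y‖ := by gcongr
    have h5 := mul_le_mul_of_nonneg_right hlT hB0
    linarith

/-- The displacement from free flight, under the hypotheses of `norm_pos_le`. -/
theorem norm_pos_last_le (h : IsLeapfrog η x v a y) (hη : 0 ≤ η) {l b T : ℝ} {N : ℕ}
    (hT : T = N * η) (hl : 0 ≤ l) (hb : 0 ≤ b) (hlT : l * T ^ 2 ≤ 1 / 4)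
    (ha : ∀ j < N, ‖a j‖ ≤ l * ‖x j‖ + b) :
    ‖x N - x 0 - T • y‖ ≤ 1 / 7 * (‖x 0‖ + T * ‖y‖ + 4 * T ^ 2 * b) := by
  have hB := h.norm_pos_le hη hT hl hb hlT ha
  have hT0 : 0 ≤ T := by rw [hT]; positivity
  set B := 8 / 7 * (‖x 0‖ + T * ‖y‖ + T ^ 2 / 2 * b) with hBdef
  have hB0 : 0 ≤ B := by positivity
  have hA : ∀ j < N, ‖a j‖ ≤ l * B + b := fun j hj =>
    (ha j hj).trans (by gcongr; exact hB j hj.le)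
  have h1 := h.norm_pos_sub_le hη hA N le_rfl
  rw [← hT] at h1
  have h5 := mul_le_mul_of_nonneg_right hlT hB0
  linarith

end IsLeapfrog

/-! ### The standard Gaussian measure -/

/-- The standard Gaussian has a density proportional to `exp (-‖p‖² / 2)`; the normalizing constant
plays no role. -/
theorem exists_stdGaussian_eq_withDensity (d : ℕ) :
    ∃ C : ℝ, 0 < C ∧ stdGaussian (State d) = (volume : Measure (State d)).withDensity
      fun p => ENNReal.ofReal (C * Real.exp (-‖p‖ ^ 2 / 2)) := by
  set V : ℂ := (Real.pi / (1 / 2 : ℂ)) ^ ((Module.finrank ℝ (State d) : ℂ) / 2) with hV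
  set W : ℝ := (Real.pi / (1 / 2 : ℝ)) ^ ((Module.finrank ℝ (State d) : ℝ) / 2) with hW
  have hWpos : 0 < W := by rw [hW]; positivity
  have hVW : V = (W : ℂ) := by
    rw [hV, hW, Complex.ofReal_cpow (by positivity)]
    push_cast
    rfl
  have hint : Integrable fun p : State d => W⁻¹ * Real.exp (-‖p‖ ^ 2 / 2) := by
    refine Integrable.const_mul ?_ _
    have h := (GaussianFourier.integrable_cexp_neg_mul_sq_norm_add (V := State d)
      (b := 1 / 2) (by norm_num) 0 0).re
    refine h.congr (Filter.Eventually.of_forall fun p => ?_)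
    have : (-(1 / 2 : ℂ) * (‖p‖ : ℂ) ^ 2 + 0 * ((inner ℝ (0 : State d) p : ℝ) : ℂ))
        = ((-‖p‖ ^ 2 / 2 : ℝ) : ℂ) := by push_cast; ring
    simp only [this, ← Complex.ofReal_exp]
    rfl
  refine ⟨W⁻¹, inv_pos.mpr hWpos, ?_⟩
  have hfin : IsFiniteMeasure ((volume : Measure (State d)).withDensity
      fun p => ENNReal.ofReal (W⁻¹ * Real.exp (-‖p‖ ^ 2 / 2))) :=
    isFiniteMeasure_withDensity_ofReal hint.2
  apply Measure.ext_of_charFun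
  ext t
  rw [charFun_stdGaussian, charFun_apply, integral_withDensity_eq_integral_toReal_smul
    (by fun_prop) (by simp)]
  have key := GaussianFourier.integral_cexp_neg_mul_sq_norm_add (V := State d)
      (b := 1 / 2) (by norm_num) Complex.I t
  rw [← hV, hVW] at key
  have e : ∀ p : State d, (ENNReal.ofReal (W⁻¹ * Real.exp (-‖p‖ ^ 2 / 2))).toReal •
      Complex.exp ((inner ℝ p t : ℝ) * Complex.I)
      = (W : ℂ)⁻¹ * Complex.exp (-(1 / 2) * (‖p‖ : ℂ) ^ 2 + Complex.I * (inner ℝ t p : ℝ)) := by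
    intro p
    rw [ENNReal.toReal_ofReal (by positivity), Complex.real_smul, Complex.exp_add,
      real_inner_comm]
    push_cast
    ring_nf
  simp_rw [e]
  rw [integral_const_mul, key, ← mul_assoc, inv_mul_cancel₀ (by exact_mod_cast hWpos.ne'), one_mul]
  congr 1
  rw [Complex.I_sq]
  ring

theorem memLp_two_inner_stdGaussian {d : ℕ} (v : State d) :
    MemLp (fun p => ⟪v, p⟫) 2 (stdGaussian (State d)) :=
  MemLp.const_inner v IsGaussian.memLp_two_id

theorem integral_inner_stdGaussian {d : ℕ} (v : State d) :
    ∫ p, ⟪v, p⟫ ∂stdGaussian (State d) = 0 :=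
  integral_strongDual_stdGaussian (innerSL ℝ v)

theorem integral_inner_sq_stdGaussian {d : ℕ} (v : State d) :
    ∫ p, ⟪v, p⟫ ^ 2 ∂stdGaussian (State d) = ‖v‖ ^ 2 := by
  have h1 := variance_dual_stdGaussian (innerSL ℝ v)
  have h2 := variance_eq_sub (memLp_two_inner_stdGaussian v)
  rw [integral_inner_stdGaussian] at h2
  rw [innerSL_apply_norm] at h1
  change Var[fun p => ⟪v, p⟫; stdGaussian (State d)] = _ at h1
  rw [h1] at h2
  simpa using h2.symm

theorem integrable_norm_sq_stdGaussian (d : ℕ) :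
    Integrable (fun p => ‖p‖ ^ 2) (stdGaussian (State d)) :=
  IsGaussian.memLp_two_id.integrable_norm_pow (by norm_num)

theorem integral_norm_sq_stdGaussian (d : ℕ) :
    ∫ p, ‖p‖ ^ 2 ∂stdGaussian (State d) = d := by
  have e : ∀ p : State d, ‖p‖ ^ 2 = ∑ i, ⟪EuclideanSpace.single i (1 : ℝ), p⟫ ^ 2 := by
    intro p
    rw [EuclideanSpace.norm_sq_eq]
    simp [EuclideanSpace.inner_single_left]
  simp_rw [e]
  rw [integral_finsetSum _ fun i _ => (memLp_two_inner_stdGaussian _).integrable_sq]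
  simp [integral_inner_sq_stdGaussian]

theorem stdGaussian_norm_sq_ge_le {d : ℕ} (hd : 1 ≤ d) :
    (stdGaussian (State d)).real {p | 16 * (d : ℝ) ≤ ‖p‖ ^ 2} ≤ 1 / 16 := by
  have h := mul_meas_ge_le_integral_of_nonneg (μ := stdGaussian (State d))
    (f := fun p => ‖p‖ ^ 2) (Filter.Eventually.of_forall fun p => by positivity)
    (integrable_norm_sq_stdGaussian d) (16 * (d : ℝ))
  rw [integral_norm_sq_stdGaussian] at h
  have hd' : (1 : ℝ) ≤ d := by exact_mod_cast hd
  have : (d : ℝ) * (16 * (stdGaussian (State d)).real {p | 16 * (d : ℝ) ≤ ‖p‖ ^ 2}) ≤ d * 1 := by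
    linarith
  have := le_of_mul_le_mul_left this (by linarith)
  linarith

/-! ### Gaussian measure under near-translations -/

/-- An antilipschitz self-map of `ℝ^d` does not expand preimages by more than the `d`-th power of
its constant.  This replaces the Jacobian determinant in the change of variables. -/
theorem _root_.AntilipschitzWith.volume_preimage_le {d : ℕ} {φ : State d → State d} {C : ℝ≥0}
    (hφ : AntilipschitzWith C φ) (s : Set (State d)) :
    volume (φ ⁻¹' s) ≤ (C : ℝ≥0∞) ^ d * volume s := by
  have h := hφ.hausdorffMeasure_preimage_le (d := (d : ℝ)) (by positivity) s
  rw [ENNReal.rpow_natCast] at h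
  rw [Measure.isAddLeftInvariant_eq_smul (volume : Measure (State d))
    (Measure.hausdorffMeasure (d : ℝ))]
  simp only [Measure.smul_apply, ENNReal.smul_def, smul_eq_mul]
  calc _ ≤ _ * ((C : ℝ≥0∞) ^ d * _) := by gcongr
    _ = _ := by ring

/-- If `φ` differs from the identity by a map that is bounded by `1/3` and has Lipschitz constant
`ε` with `d ε ≤ 1/15`, then the law of `φ p` for Gaussian `p` is close to Gaussian.  Under `φ` the
Gaussian density changes by a factor `exp (-u)` with `u = (‖φ p‖² - ‖p‖²) / 2`, and volumes shrink
by at most the factor `(1 - ε)^d`. -/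
theorem stdGaussian_preimage_sub_le {d : ℕ} {φ : State d → State d} {ε : ℝ}
    (hε : 0 ≤ ε) (hdε : d * ε ≤ 1 / 15) (hε1 : ε < 1) (hbound : ∀ p, ‖φ p - p‖ ≤ 1 / 3)
    (hlip : ∀ p p', ‖(φ p - p) - (φ p' - p')‖ ≤ ε * ‖p - p'‖)
    {B : Set (State d)} (hB : MeasurableSet B) :
    (stdGaussian (State d)).real (φ ⁻¹' B) - (stdGaussian (State d)).real B ≤ 1 / 2 := by
  set γ := stdGaussian (State d) with hγ
  have hcont : Continuous φ := by
    have h1 : LipschitzWith ε.toNNReal fun p => φ p - p := by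
      refine LipschitzWith.of_dist_le_mul fun p p' => ?_
      rw [dist_eq_norm, dist_eq_norm, Real.coe_toNNReal _ hε]
      exact hlip p p'
    exact (h1.continuous.add continuous_id).congr fun p => sub_add_cancel (φ p) p
  have hanti : AntilipschitzWith (Real.toNNReal (1 - ε)⁻¹) φ := by
    refine AntilipschitzWith.of_le_mul_dist fun p p' => ?_
    have h1ε : 0 < 1 - ε := by linarith
    rw [dist_eq_norm, dist_eq_norm, Real.coe_toNNReal _ (by positivity), inv_mul_eq_div,
      le_div_iff₀ h1ε]
    have e : p - p' = (φ p - φ p') - ((φ p - p) - (φ p' - p')) := by abel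
    have h2 := norm_sub_le (φ p - φ p') ((φ p - p) - (φ p' - p'))
    rw [← e] at h2
    linarith [hlip p p']
  set κ : ℝ := (1 - ε) ^ d with hκ
  have hκ0 : 0 ≤ κ := pow_nonneg (by linarith) _
  have hκ1 : κ ≤ 1 := pow_le_one₀ (by linarith) (by linarith)
  have hκd : 1 - κ ≤ d * ε := by
    have := one_add_mul_le_pow (a := -ε) (by linarith) d
    rw [← sub_eq_add_neg, ← hκ] at this
    linarith
  obtain ⟨c, hc, hdens⟩ := exists_stdGaussian_eq_withDensity d
  rw [← hγ] at hdens
  set ρ : State d → ℝ≥0∞ := fun p => ENNReal.ofReal (c * Real.exp (-‖p‖ ^ 2 / 2)) with hρ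
  have hρm : Measurable ρ := by rw [hρ]; fun_prop
  set u : State d → ℝ := fun p => (‖φ p‖ ^ 2 - ‖p‖ ^ 2) / 2 with hu
  have hum : Measurable u := by
    have := hcont.measurable
    rw [hu]; fun_prop
  have hmap : (volume : Measure (State d)).map φ ≤
      ((Real.toNNReal (1 - ε)⁻¹ : ℝ≥0) : ℝ≥0∞) ^ d • volume := by
    refine Measure.le_iff.mpr fun s hs => ?_
    rw [Measure.map_apply hcont.measurable hs]
    simpa using hanti.volume_preimage_le s
  have hlow : ∫⁻ p in φ ⁻¹' B, ENNReal.ofReal (κ * Real.exp (-u p)) ∂γ ≤ γ B := by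
    have hS := hcont.measurable hB
    calc ∫⁻ p in φ ⁻¹' B, ENNReal.ofReal (κ * Real.exp (-u p)) ∂γ
        = ∫⁻ p in φ ⁻¹' B, ENNReal.ofReal κ * ρ (φ p) := by
          rw [hdens, setLIntegral_withDensity_eq_setLIntegral_mul _ hρm (by fun_prop) hS]
          refine setLIntegral_congr_fun hS fun p _ => ?_
          simp only [Pi.mul_apply, hρ]
          rw [← ENNReal.ofReal_mul (by positivity), ← ENNReal.ofReal_mul hκ0]
          congr 1
          have : Real.exp (-‖φ p‖ ^ 2 / 2) = Real.exp (-‖p‖ ^ 2 / 2) * Real.exp (-u p) := by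
            rw [← Real.exp_add, hu]; congr 1; ring
          rw [this]; ring
      _ = ENNReal.ofReal κ * ∫⁻ p in φ ⁻¹' B, ρ (φ p) :=
          lintegral_const_mul _ (hρm.comp hcont.measurable)
      _ = ENNReal.ofReal κ * ∫⁻ y in B, ρ y ∂((volume : Measure (State d)).map φ) := by
          rw [setLIntegral_map hB hρm hcont.measurable]
      _ ≤ ENNReal.ofReal κ * ∫⁻ y in B, ρ y
            ∂(((Real.toNNReal (1 - ε)⁻¹ : ℝ≥0) : ℝ≥0∞) ^ d • (volume : Measure (State d))) := by
          gcongr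
      _ = γ B := by
          rw [Measure.restrict_smul, lintegral_smul_measure, hdens, withDensity_apply _ hB,
            smul_eq_mul, ← mul_assoc]
          have : ENNReal.ofReal κ * ((Real.toNNReal (1 - ε)⁻¹ : ℝ≥0) : ℝ≥0∞) ^ d = 1 := by
            change _ * (ENNReal.ofReal (1 - ε)⁻¹) ^ d = 1
            have h1ε : 0 < 1 - ε := by linarith
            rw [← ENNReal.ofReal_pow (by positivity), ← ENNReal.ofReal_mul hκ0, hκ, ← mul_pow,
              mul_inv_cancel₀ h1ε.ne']
            simp
          rw [this, one_mul]
  set h₀ : State d := φ 0 - 0 with hh₀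
  have hh₀b : ‖h₀‖ ≤ 1 / 3 := hbound 0
  -- The positive part of `x = ⟪h₀, p⟫` is bounded by `(3/4) (x + 1/3)²`, which has mean at
  -- most `1/6`; bounding it by `|x|` instead would lose a factor `2`.
  set w : State d → ℝ := fun p =>
    (d * ε + 1 / 18 + 1 / 12) + ε * ‖p‖ ^ 2 + 1 / 2 * ⟪h₀, p⟫ + 3 / 4 * ⟪h₀, p⟫ ^ 2 with hw
  have hw0 : ∀ p, 0 ≤ w p := by
    intro p
    have h1 : 0 ≤ ε * ‖p‖ ^ 2 := by positivity
    have h2 : 0 ≤ (d : ℝ) * ε := by positivity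
    simp only [hw]
    nlinarith [sq_nonneg (⟪h₀, p⟫ + 1 / 3)]
  have hpt : ∀ p, 1 ≤ κ * Real.exp (-u p) + w p := by
    intro p
    have h1 : -u p + 1 ≤ Real.exp (-u p) := Real.add_one_le_exp _
    have h2 := mul_le_mul_of_nonneg_left h1 hκ0
    have e : u p = ⟪h₀, p⟫ + ⟪(φ p - p) - h₀, p⟫ + ‖φ p - p‖ ^ 2 / 2 := by
      have : ‖φ p‖ ^ 2 = ‖(φ p - p) + p‖ ^ 2 := by rw [sub_add_cancel]
      rw [norm_add_sq_real] at this
      rw [inner_sub_left _ h₀, hu]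
      simp only [this]
      ring
    have h3 : ⟪(φ p - p) - h₀, p⟫ ≤ ε * ‖p‖ ^ 2 := by
      refine (real_inner_le_norm _ _).trans ?_
      have := hlip p 0
      rw [← hh₀, sub_zero] at this
      nlinarith [norm_nonneg p]
    have h4 : ‖φ p - p‖ ^ 2 ≤ 1 / 9 := by nlinarith [hbound p, norm_nonneg (φ p - p)]
    have h5 : u p ≤ w p - d * ε := by
      simp only [hw]
      nlinarith [sq_nonneg (⟪h₀, p⟫ - 1 / 3)]
    have h6 : 0 ≤ w p - d * ε := by
      have h1 : 0 ≤ ε * ‖p‖ ^ 2 := by positivity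
      simp only [hw]
      nlinarith [sq_nonneg (⟪h₀, p⟫ + 1 / 3)]
    have h7 : κ * u p ≤ w p - d * ε :=
      (mul_le_mul_of_nonneg_left h5 hκ0).trans (mul_le_of_le_one_left h6 hκ1)
    linarith
  have hwi : Integrable w γ :=
    (((integrable_const _).add ((integrable_norm_sq_stdGaussian d).const_mul ε)).add
      (((memLp_two_inner_stdGaussian h₀).integrable (by norm_num)).const_mul (1 / 2))).add
      ((memLp_two_inner_stdGaussian h₀).integrable_sq.const_mul (3 / 4))
  have hwint : ∫ p, w p ∂γ ≤ 1 / 2 := by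
    have : ∫ p, w p ∂γ = (d * ε + 1 / 18 + 1 / 12) + ε * d + 1 / 2 * 0 + 3 / 4 * ‖h₀‖ ^ 2 := by
      rw [hw, integral_add, integral_add, integral_add, integral_const_mul, integral_const_mul,
        integral_const_mul, integral_inner_stdGaussian, integral_inner_sq_stdGaussian,
        integral_norm_sq_stdGaussian]
      · simp
      · exact integrable_const _
      · exact (integrable_norm_sq_stdGaussian d).const_mul ε
      · exact (integrable_const _).add ((integrable_norm_sq_stdGaussian d).const_mul ε)
      · exact ((memLp_two_inner_stdGaussian h₀).integrable (by norm_num)).const_mul (1 / 2)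
      · exact ((integrable_const _).add ((integrable_norm_sq_stdGaussian d).const_mul ε)).add
          (((memLp_two_inner_stdGaussian h₀).integrable (by norm_num)).const_mul (1 / 2))
      · exact (memLp_two_inner_stdGaussian h₀).integrable_sq.const_mul (3 / 4)
    rw [this]
    nlinarith [norm_nonneg h₀]
  have hfinal : γ (φ ⁻¹' B) ≤ γ B + ENNReal.ofReal (1 / 2) := by
    calc γ (φ ⁻¹' B) = ∫⁻ p in φ ⁻¹' B, 1 ∂γ := by simp
      _ ≤ ∫⁻ p in φ ⁻¹' B, (ENNReal.ofReal (κ * Real.exp (-u p)) + ENNReal.ofReal (w p)) ∂γ := by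
          refine lintegral_mono fun p => ?_
          rw [← ENNReal.ofReal_add (by positivity) (hw0 p)]
          exact ENNReal.one_le_ofReal.mpr (hpt p)
      _ = ∫⁻ p in φ ⁻¹' B, ENNReal.ofReal (κ * Real.exp (-u p)) ∂γ
          + ∫⁻ p in φ ⁻¹' B, ENNReal.ofReal (w p) ∂γ := lintegral_add_left (by fun_prop) _
      _ ≤ γ B + ∫⁻ p, ENNReal.ofReal (w p) ∂γ :=
          add_le_add hlow (setLIntegral_le_lintegral _ _)
      _ = γ B + ENNReal.ofReal (∫ p, w p ∂γ) := by
          rw [ofReal_integral_eq_lintegral_ofReal hwi (Filter.Eventually.of_forall hw0)]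
      _ ≤ _ := by gcongr
  have := ENNReal.toReal_mono (by simp) hfinal
  rw [ENNReal.toReal_add (by simp) (by simp), ENNReal.toReal_ofReal (by norm_num)] at this
  rw [measureReal_def, measureReal_def]
  linarith

/-! ### Total variation distance -/

theorem tvDist_le {α : Type*} [MeasurableSpace α] {P Q : Measure α} [IsProbabilityMeasure P]
    [IsProbabilityMeasure Q] {r : ℝ} (hr : 0 ≤ r)
    (h : ∀ A, MeasurableSet A → P.real A - Q.real A ≤ r) : tvDist P Q ≤ r := by
  refine Real.sSup_le ?_ hr
  rintro _ ⟨A, hA, rfl⟩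
  refine abs_le.mpr ⟨?_, h A hA⟩
  have := h Aᶜ hA.compl
  rw [probReal_compl_eq_one_sub hA, probReal_compl_eq_one_sub hA] at this
  linarith

/-! ### Leapfrog trajectories -/

section Trajectory

variable {d : ℕ} {f : State d → ℝ} {L LH η : ℝ}

/-- The position `q_k` after `k` leapfrog updates from position `q` with momentum `p`. -/
noncomputable def position (f : State d → ℝ) (η : ℝ) (q p : State d) (k : ℕ) : State d :=
  ((leapfrog f η)^[k] (p, q)).2

/-- The momentum `p_{k+1/2}`, halfway through the update after the `k`-th one. -/
noncomputable def halfMomentum (f : State d → ℝ) (η : ℝ) (q p : State d) (k : ℕ) : State d :=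
  ((leapfrog f η)^[k] (p, q)).1 - (η / 2) • ∇ f (position f η q p k)

@[simp] theorem position_zero (q p : State d) : position f η q p 0 = q := rfl

theorem endState_snd (K : ℕ) (q p : State d) : (endState f K η q p).2 = position f η q p K := rfl

theorem position_succ (q p : State d) (k : ℕ) :
    position f η q p (k + 1) = position f η q p k + η • halfMomentum f η q p k := by
  simp only [position, halfMomentum, Function.iterate_succ_apply', leapfrog]

theorem isLeapfrog_position (f : State d → ℝ) (η : ℝ) (q p : State d) :
    IsLeapfrog η (position f η q p) (halfMomentum f η q p) (fun k => ∇ f (position f η q p k)) p where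
  pos := position_succ q p
  init := rfl
  mom k := by
    have h : ((leapfrog f η)^[k + 1] (p, q)).1
        = halfMomentum f η q p k - (η / 2) • ∇ f (position f η q p (k + 1)) := by
      rw [position_succ]
      simp only [position, halfMomentum, Function.iterate_succ_apply', leapfrog]
    rw [halfMomentum, h]
    module

theorem IsSmoothWith.continuous_gradient (hf : IsSmoothWith f L) (hL : 0 ≤ L) :
    Continuous (∇ f) := by
  refine (LipschitzWith.of_dist_le_mul (K := L.toNNReal) fun x y => ?_).continuous
  rw [dist_eq_norm, dist_eq_norm, Real.coe_toNNReal _ hL]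
  exact hf.2 x y

theorem continuous_endState (hf : Continuous (∇ f)) (K : ℕ) (x : State d) :
    Continuous (endState f K η x) := by
  have h1 : Continuous (leapfrog f η) := by
    unfold leapfrog
    fun_prop
  exact (h1.iterate K).comp (by fun_prop)

/-- A second difference of the gradient along the vertices of a quadrilateral: it is small
quadratically in the sides, up to the failure of the quadrilateral to be a parallelogram. -/
theorem norm_gradient_second_difference_le (hf : IsSmoothWith f L) (hH : IsHessianLipschitz f LH)
    (w x y z : State d) :
    ‖(∇ f w - ∇ f x) - (∇ f y - ∇ f z)‖ ≤
      L * ‖(w - x) - (y - z)‖ + LH * ‖w - x‖ * ‖w - y‖ := by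
  set u := w - x with hu
  have hG : ∀ t, HasFDerivAt (fun t => ∇ f t - ∇ f (t - u)) (hessian f t - hessian f (t - u)) t := by
    intro t
    have h2 : HasFDerivAt (fun t => ∇ f (t - u)) (hessian f (t - u)) t :=
      (hasFDerivAt_comp_sub u).mpr (hH.2.1 (t - u)).hasFDerivAt
    exact (hH.2.1 t).hasFDerivAt.sub h2
  have h1 := convex_univ.norm_image_sub_le_of_norm_hasFDerivWithin_le (C := LH * ‖u‖)
    (fun t _ => (hG t).hasFDerivWithinAt)
    (fun t _ => by simpa using hH.2.2 t (t - u)) (Set.mem_univ y) (Set.mem_univ w)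
  have h2 := hf.2 (y - u) z
  have e1 : w - u = x := by rw [hu]; abel
  have e2 : (∇ f w - ∇ f x) - (∇ f y - ∇ f z)
      = ((∇ f w - ∇ f (w - u)) - (∇ f y - ∇ f (y - u))) - (∇ f (y - u) - ∇ f z) := by
    rw [e1]; abel
  have e3 : ‖y - u - z‖ = ‖u - (y - z)‖ := by rw [← norm_neg]; congr 1; abel
  rw [e3] at h2
  rw [e2]
  linarith [norm_sub_le ((∇ f w - ∇ f (w - u)) - (∇ f y - ∇ f (y - u))) (∇ f (y - u) - ∇ f z)]

end Trajectory

/-! ### Overlap of the proposals -/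

section Overlap

variable {d : ℕ} {f : State d → ℝ} {L LH η : ℝ} {K : ℕ} {T : ℝ}

/-- For a short total time, every end position is reached for some initial momentum: the end
position differs from `q + T p` by a function of `T p` with Lipschitz constant `1/7`. -/
theorem exists_momentum (hf : IsSmoothWith f L) (hL : 0 ≤ L) (hη : 0 < η) (hK : 1 ≤ K)
    (hT : T = K * η) (hLT : L * T ^ 2 ≤ 1 / 4) (q y : State d) :
    ∃ p, position f η q p K = y := by
  have hK' : (0 : ℝ) < K := by exact_mod_cast hK
  have hT0 : 0 < T := by rw [hT]; positivity
  set Ψ : State d → State d := fun p => p - T⁻¹ • (position f η q p K - y) with hΨ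
  have hc : ContractingWith (1 / 7) Ψ := by
    refine ⟨by rw [div_lt_one (by norm_num)]; norm_num, LipschitzWith.of_dist_le_mul fun p p' => ?_⟩
    have h := ((isLeapfrog_position f η q p).sub (isLeapfrog_position f η q p')).norm_pos_last_le
      hη.le hT hL le_rfl hLT (fun j _ => by simpa using hf.2 _ _)
    simp only [position_zero, sub_self, sub_zero, norm_zero, zero_add, mul_zero, add_zero] at h
    have e : Ψ p - Ψ p' = -(T⁻¹ • (position f η q p K - position f η q p' K - T • (p - p'))) := by
      rw [smul_sub _ _ (T • (p - p')), smul_smul, inv_mul_cancel₀ hT0.ne', hΨ]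
      module
    rw [dist_eq_norm, dist_eq_norm, e, norm_neg, norm_smul, norm_inv, Real.norm_of_nonneg hT0.le,
      inv_mul_le_iff₀ hT0]
    push_cast
    linarith
  refine ⟨hc.fixedPoint, ?_⟩
  have h : Ψ hc.fixedPoint = hc.fixedPoint := hc.fixedPoint_isFixedPt
  have h2 : T⁻¹ • (position f η q hc.fixedPoint K - y) = 0 := sub_eq_self.mp h
  rcases smul_eq_zero.mp h2 with h3 | h3
  · exact absurd h3 (inv_pos.mpr hT0).ne'
  · exact sub_eq_zero.mp h3

/-- Two trajectories with the same end: their momenta differ little. -/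
theorem norm_momentum_sub_le (hf : IsSmoothWith f L) (hL : 0 ≤ L) (hη : 0 < η)
    (hT : T = K * η) (hLT : L * T ^ 2 ≤ 1 / 4) {q q' p p' : State d}
    (h : position f η q' p' K = position f η q p K) :
    T * ‖p' - p‖ ≤ 4 / 3 * ‖q - q'‖ := by
  have hT0 : 0 ≤ T := by rw [hT]; positivity
  have h1 := ((isLeapfrog_position f η q' p').sub (isLeapfrog_position f η q p)).norm_pos_last_le
    hη.le hT hL le_rfl hLT (fun j _ => by simpa using hf.2 _ _)
  simp only [position_zero, h, sub_self, zero_sub, mul_zero, add_zero] at h1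
  have e : -(q' - q) - T • (p' - p) = (q - q') - T • (p' - p) := by abel
  rw [e, norm_sub_rev q' q] at h1
  have h2 := norm_sub_norm_le (T • (p' - p)) (q - q')
  rw [norm_sub_rev _ (q - q'), norm_smul, Real.norm_of_nonneg hT0] at h2
  linarith

/-- The momentum change `φ p - p` that keeps the end position when the start moves from `q` to
`q'` is a Lipschitz function of `p`, with a constant of order `LH T³`: this is a second-difference
estimate for four trajectories. -/
theorem norm_momentum_sub_sub_le (hf : IsSmoothWith f L) (hH : IsHessianLipschitz f LH)
    (hL : 0 ≤ L) (hLH : 0 ≤ LH) (hη : 0 < η) (hK : 1 ≤ K)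
    (hT : T = K * η) (hLT : L * T ^ 2 ≤ 1 / 4) {q q' : State d} (hq : ‖q - q'‖ ≤ T / 4)
    {φ : State d → State d} (hφ : ∀ p, position f η q' (φ p) K = position f η q p K)
    (p p' : State d) :
    ‖(φ p - p) - (φ p' - p')‖ ≤ 32 / 63 * (LH * T ^ 3) * ‖p - p'‖ := by
  have hK' : (0 : ℝ) < K := by exact_mod_cast hK
  have hT0 : 0 < T := by rw [hT]; positivity
  have hu : ∀ j ≤ K, ‖position f η q' (φ p) j - position f η q p j‖ ≤ 2 / 3 * T := by
    intro j hj
    have h1 := ((isLeapfrog_position f η q' (φ p)).sub (isLeapfrog_position f η q p)).norm_pos_le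
      hη.le hT hL le_rfl hLT (fun j _ => by simpa using hf.2 _ _) j hj
    have h2 := norm_momentum_sub_le hf hL hη hT hLT (hφ p)
    simp only [position_zero, mul_zero, add_zero, norm_sub_rev q' q] at h1
    linarith
  have hv : ∀ j ≤ K, ‖position f η q p j - position f η q p' j‖ ≤ 8 / 7 * (T * ‖p - p'‖) := by
    intro j hj
    have h1 := ((isLeapfrog_position f η q p).sub (isLeapfrog_position f η q p')).norm_pos_le
      hη.le hT hL le_rfl hLT (fun j _ => by simpa using hf.2 _ _) j hj
    simpa using h1
  have h1 := (((isLeapfrog_position f η q p).sub (isLeapfrog_position f η q' (φ p))).sub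
    ((isLeapfrog_position f η q p').sub (isLeapfrog_position f η q' (φ p')))).norm_pos_last_le
    hη.le (b := LH * (2 / 3 * T) * (8 / 7 * (T * ‖p - p'‖))) hT hL (by positivity) hLT
    (fun j hj => by
      refine (norm_gradient_second_difference_le hf hH _ _ _ _).trans ?_
      gcongr
      · rw [norm_sub_rev]; exact hu j hj.le
      · exact hv j hj.le)
  simp only [position_zero, hφ, sub_self, zero_sub, norm_neg, norm_zero, zero_add] at h1
  have e : p - φ p - (p' - φ p') = -((φ p - p) - (φ p' - p')) := by abel
  rw [e, smul_neg, norm_neg, norm_neg, norm_smul, Real.norm_of_nonneg hT0.le] at h1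
  refine le_of_mul_le_mul_left ?_ hT0
  linarith

theorem isProbabilityMeasure_proposal (hg : Continuous (∇ f)) (x : State d) :
    IsProbabilityMeasure (proposal f K η x) :=
  Measure.isProbabilityMeasure_map
    (continuous_snd.comp (continuous_endState hg K x)).measurable.aemeasurable

/-- Proposals from nearby starting points overlap. -/
theorem tvDist_proposal_le (hf : IsSmoothWith f L) (hH : IsHessianLipschitz f LH)
    (hL : 0 ≤ L) (hLH : 0 ≤ LH) (hd : 1 ≤ d) (hη : 0 < η) (hK : 1 ≤ K) (hT : T = K * η)
    (hLT : L * T ^ 2 ≤ 1 / 4) (hLHT : d * (LH * T ^ 3) ≤ 1 / 8) {q q' : State d}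
    (hq : ‖q - q'‖ ≤ T / 4) :
    tvDist (proposal f K η q) (proposal f K η q') ≤ 1 / 2 := by
  have hK' : (0 : ℝ) < K := by exact_mod_cast hK
  have hT0 : 0 < T := by rw [hT]; positivity
  have hd1 : (1 : ℝ) ≤ d := by exact_mod_cast hd
  have hg := hf.continuous_gradient hL
  have := isProbabilityMeasure_proposal (K := K) (η := η) hg q
  have := isProbabilityMeasure_proposal (K := K) (η := η) hg q'
  have hF : ∀ q : State d, Measurable fun p => (endState f K η q p).2 := fun q =>
    (continuous_snd.comp (continuous_endState hg K q)).measurable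
  -- `φ p` is the momentum that leads from `q'` to the end of the trajectory of `(p, q)`.
  choose φ hφ using fun p => exists_momentum hf hL hη hK hT hLT q' (position f η q p K)
  refine tvDist_le (by norm_num) fun A hA => ?_
  have hε0 : 0 ≤ LH * T ^ 3 := by positivity
  have hε1 : LH * T ^ 3 ≤ d * (LH * T ^ 3) := le_mul_of_one_le_left hε0 hd1
  have h := stdGaussian_preimage_sub_le (φ := φ) (ε := 32 / 63 * (LH * T ^ 3))
    (by positivity) (by linarith) (by linarith)
    (fun p => by
      have h1 := norm_momentum_sub_le hf hL hη hT hLT (hφ p)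
      exact le_of_mul_le_mul_left (by linarith) hT0)
    (norm_momentum_sub_sub_le hf hH hL hLH hη hK hT hLT hq hφ) (hF q' hA)
  rw [measureReal_def, measureReal_def, proposal, proposal, Measure.map_apply (hF q) hA,
    Measure.map_apply (hF q') hA]
  have e : φ ⁻¹' ((fun p => (endState f K η q' p).2) ⁻¹' A)
      = (fun p => (endState f K η q p).2) ⁻¹' A := by
    ext p
    simp only [Set.mem_preimage, endState_snd, hφ]
  rwa [e] at h

end Overlap

/-! ### Conservation of energy -/

section Energy

variable {d : ℕ} {f : State d → ℝ} {L LH η : ℝ}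

/-- Error of the trapezoidal rule for the increment of `f`. -/
theorem trapezoid_error_le (hH : IsHessianLipschitz f LH) (hLH : 0 ≤ LH) (x u : State d) :
    f (x + u) - f x - ⟪u, ∇ f x + ∇ f (x + u)⟫ / 2 ≤ LH / 2 * ‖u‖ ^ 3 := by
  have hline : ∀ t : ℝ, HasDerivAt (fun t : ℝ => x + t • u) u t := fun t => by
    simpa using ((hasDerivAt_id t).smul_const u).const_add x
  have hf' : ∀ t : ℝ, HasDerivAt (fun t : ℝ => f (x + t • u)) ⟪∇ f (x + t • u), u⟫ t := fun t => by
    have h := (hH.1 (x + t • u)).hasGradientAt.hasFDerivAt.comp_hasDerivAt t (hline t)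
    rw [InnerProductSpace.toDual_apply_apply] at h
    exact h
  have hg' : ∀ t : ℝ, HasDerivAt (fun t : ℝ => ⟪∇ f (x + t • u), u⟫)
      ⟪hessian f (x + t • u) u, u⟫ t := fun t => by
    have h := (hH.2.1 (x + t • u)).hasFDerivAt.comp_hasDerivAt t (hline t)
    exact (h.inner ℝ (hasDerivAt_const t u)).congr_deriv (by simp [hessian])
  set φ₁ : ℝ → ℝ := fun t => ⟪∇ f (x + t • u), u⟫ with hφ₁
  set φ₂ : ℝ → ℝ := fun t => ⟪hessian f (x + t • u) u, u⟫ with hφ₂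
  have hlip : ∀ s t : ℝ, |φ₂ s - φ₂ t| ≤ LH * ‖u‖ ^ 3 * |s - t| := by
    intro s t
    rw [hφ₂]
    simp only
    rw [← inner_sub_left, ← sub_apply]
    refine (abs_real_inner_le_norm _ _).trans ?_
    have h1 := (hessian f (x + s • u) - hessian f (x + t • u)).le_opNorm u
    have h2 := hH.2.2 (x + s • u) (x + t • u)
    have e : x + s • u - (x + t • u) = (s - t) • u := by module
    rw [e, norm_smul, Real.norm_eq_abs] at h2
    calc _ ≤ LH * (|s - t| * ‖u‖) * ‖u‖ * ‖u‖ := by gcongr; exact h1.trans (by gcongr)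
      _ = _ := by ring
  -- The derivative of the trapezoidal error in the length `t` of the segment is half the error of
  -- a first-order expansion of `φ₁`.
  have hψ : ∀ t : ℝ, HasDerivAt (fun t : ℝ => f (x + t • u) - t / 2 * (φ₁ 0 + φ₁ t))
      ((φ₁ t - φ₁ 0 - t * φ₂ t) / 2) t := fun t => by
    have h := (hf' t).sub (((hasDerivAt_id t).div_const 2).mul ((hg' t).const_add (φ₁ 0)))
    refine h.congr_deriv ?_
    simp only [id]
    ring
  have hψb : ∀ t ∈ Set.Icc (0 : ℝ) 1, ‖(φ₁ t - φ₁ 0 - t * φ₂ t) / 2‖ ≤ LH / 2 * ‖u‖ ^ 3 := by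
    intro t ht
    have h1 := (convex_Icc (0 : ℝ) t).norm_image_sub_le_of_norm_hasDerivWithin_le
      (f := fun s => φ₁ s - s * φ₂ t) (f' := fun s => φ₂ s - φ₂ t) (C := LH * ‖u‖ ^ 3)
      (fun s _ => (((hg' s).sub ((hasDerivAt_id s).mul_const (φ₂ t))).congr_deriv
        (by simp [hφ₂])).hasDerivWithinAt)
      (fun s hs => by
        rw [Real.norm_eq_abs]
        refine (hlip s t).trans (mul_le_of_le_one_right (by positivity) ?_)
        rw [abs_le]; constructor <;> linarith [hs.1, hs.2, ht.1, ht.2])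
      (Set.left_mem_Icc.mpr ht.1) (Set.right_mem_Icc.mpr ht.1)
    rw [sub_zero, Real.norm_eq_abs t, abs_of_nonneg ht.1, zero_mul, sub_zero] at h1
    have e : (φ₁ t - φ₁ 0 - t * φ₂ t) / 2 = (φ₁ t - t * φ₂ t - φ₁ 0) / 2 := by ring
    rw [e, norm_div, Real.norm_ofNat]
    have h2 : LH * ‖u‖ ^ 3 * t ≤ LH * ‖u‖ ^ 3 := mul_le_of_le_one_right (by positivity) ht.2
    linarith
  have h := (convex_Icc (0 : ℝ) 1).norm_image_sub_le_of_norm_hasDerivWithin_le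
    (fun t _ => (hψ t).hasDerivWithinAt) hψb (Set.left_mem_Icc.mpr zero_le_one)
    (Set.right_mem_Icc.mpr zero_le_one)
  have h' := (le_abs_self _).trans h
  simp only [hφ₁, one_smul, zero_smul, add_zero, zero_div, zero_mul, sub_zero, norm_one,
    mul_one] at h'
  rw [inner_add_right, real_inner_comm, real_inner_comm _ u]
  linarith

/-- One leapfrog update changes the energy by a trapezoidal error and a term that telescopes. -/
theorem hamiltonian_leapfrog_sub_le (hH : IsHessianLipschitz f LH) (hLH : 0 ≤ LH)
    (z : State d × State d) :
    hamiltonian f (leapfrog f η z) - hamiltonian f z ≤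
      η ^ 2 / 8 * (‖∇ f (leapfrog f η z).2‖ ^ 2 - ‖∇ f z.2‖ ^ 2)
        + LH / 2 * ‖η • (z.1 - (η / 2) • ∇ f z.2)‖ ^ 3 := by
  obtain ⟨p, q⟩ := z
  have h := trapezoid_error_le hH hLH q (η • (p - (η / 2) • ∇ f q))
  simp only [leapfrog, hamiltonian]
  set g := ∇ f q
  set g' := ∇ f (q + η • (p - (η / 2) • g))
  have e1 : ‖p - (η / 2) • g - (η / 2) • g'‖ ^ 2
      = ‖p‖ ^ 2 - η * ⟪p, g + g'⟫ + η ^ 2 / 4 * (‖g‖ ^ 2 + 2 * ⟪g, g'⟫ + ‖g'‖ ^ 2) := by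
    have : p - (η / 2) • g - (η / 2) • g' = p - (η / 2) • (g + g') := by module
    rw [this, norm_sub_sq_real, inner_smul_right, norm_smul, mul_pow, norm_add_sq_real,
      Real.norm_eq_abs, sq_abs]
    ring
  have e2 : ⟪η • (p - (η / 2) • g), g + g'⟫
      = η * ⟪p, g + g'⟫ - η ^ 2 / 2 * (‖g‖ ^ 2 + ⟪g, g'⟫) := by
    rw [real_inner_smul_left, inner_sub_left, real_inner_smul_left, inner_add_right g,
      real_inner_self_eq_norm_sq]
    ring
  rw [e2] at h
  rw [e1]
  linarith

theorem hamiltonian_endState_sub_le (hH : IsHessianLipschitz f LH) (hLH : 0 ≤ LH) (hη : 0 ≤ η)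
    (x p : State d) {V : ℝ} {K : ℕ} (hV : ∀ k < K, ‖halfMomentum f η x p k‖ ≤ V) :
    hamiltonian f (endState f K η x p) - hamiltonian f (p, x) ≤
      η ^ 2 / 8 * (‖∇ f (position f η x p K)‖ ^ 2 - ‖∇ f x‖ ^ 2) + K * (LH / 2 * (η * V) ^ 3) := by
  induction K with
  | zero => simp [endState]
  | succ K ih =>
    have h1 := ih fun k hk => hV k (by omega)
    have h2 := hamiltonian_leapfrog_sub_le (η := η) hH hLH (endState f K η x p)
    have e : leapfrog f η (endState f K η x p) = endState f (K + 1) η x p := by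
      simp only [endState, Function.iterate_succ_apply']
    have h3 : ‖η • ((endState f K η x p).1 - (η / 2) • ∇ f (endState f K η x p).2)‖ ≤ η * V := by
      rw [norm_smul, Real.norm_of_nonneg hη]
      exact mul_le_mul_of_nonneg_left (hV K (by omega)) hη
    have h4 : LH / 2 * ‖η • ((endState f K η x p).1 - (η / 2) • ∇ f (endState f K η x p).2)‖ ^ 3
        ≤ LH / 2 * (η * V) ^ 3 := by gcongr
    rw [e] at h2
    simp only [endState_snd] at h2 h4
    push_cast
    linarith

/-- Energy error of a leapfrog trajectory of total time `T` that starts at a point where the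
gradient is at most `M`. -/
theorem hamiltonian_endState_sub_le_of_gradient_le (hf : IsSmoothWith f L)
    (hH : IsHessianLipschitz f LH) (hL : 0 ≤ L) (hLH : 0 ≤ LH) (hη : 0 < η) {K : ℕ} {T M : ℝ}
    (hT : T = K * η) (hLT : L * T ^ 2 ≤ 1 / 4) (hM : 0 ≤ M) {x p : State d}
    (hx : ‖∇ f x‖ ≤ M) :
    hamiltonian f (endState f K η x p) - hamiltonian f (p, x) ≤
      η ^ 2 / 2 * (M * L * T * (‖p‖ + T * M) + L ^ 2 * T ^ 2 * (‖p‖ + T * M) ^ 2)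
        + 4 * K * LH * η ^ 3 * (‖p‖ + T * M) ^ 3 := by
  have hT0 : 0 ≤ T := by rw [hT]; positivity
  set P := ‖p‖ + T * M with hP
  have hP0 : 0 ≤ P := by positivity
  have hg : ∀ y, ‖∇ f y‖ ≤ L * ‖y - x‖ + M := by
    intro y
    have h1 := hf.2 y x
    have h2 := norm_sub_norm_le (∇ f y) (∇ f x)
    linarith
  have htraj := (isLeapfrog_position f η x p).sub_const x
  have hpos : ∀ k ≤ K, ‖position f η x p k - x‖ ≤ 8 / 7 * (T * ‖p‖ + T ^ 2 / 2 * M) := by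
    have h := htraj.norm_pos_le hη.le hT hL hM hLT fun j _ => hg _
    simpa using h
  have hTM : 0 ≤ T * (T * M) := by positivity
  have hTp : 0 ≤ T * ‖p‖ := by positivity
  have hpos' : ∀ k ≤ K, ‖position f η x p k - x‖ ≤ 8 / 7 * (T * P) := fun k hk => by
    refine (hpos k hk).trans ?_
    rw [hP]; linarith
  have hV : ∀ k < K, ‖halfMomentum f η x p k‖ ≤ 2 * P := by
    intro k hk
    have hA : ∀ j < K, ‖∇ f (position f η x p j)‖ ≤ L * (8 / 7 * (T * P)) + M := fun j hj =>
      (hg _).trans (by gcongr; exact hpos' j hj.le)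
    have h1 := (isLeapfrog_position f η x p).norm_mom_sub_le hη.le hA k hk
    have hkT : (k + 1 / 2) * η ≤ T := by
      have : (k : ℝ) + 1 ≤ K := by exact_mod_cast hk
      rw [hT]
      gcongr
      linarith
    have h2 : (k + 1 / 2) * η * (L * (8 / 7 * (T * P)) + M) ≤ T * (L * (8 / 7 * (T * P)) + M) := by
      gcongr
    have h3 := mul_le_mul_of_nonneg_right hLT hP0
    have h4 := norm_sub_norm_le (halfMomentum f η x p k) p
    have h5 : 0 ≤ T * M := by positivity
    have h6 : 0 ≤ ‖p‖ := norm_nonneg p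
    linarith
  have h1 := hamiltonian_endState_sub_le hH hLH hη.le x p hV
  have h2 : ‖∇ f (position f η x p K)‖ ^ 2 - ‖∇ f x‖ ^ 2
      ≤ 4 * (M * L * T * P + L ^ 2 * T ^ 2 * P ^ 2) := by
    have ha := hf.2 (position f η x p K) x
    have hb := norm_sub_norm_le (∇ f (position f η x p K)) (∇ f x)
    have hD : L * ‖position f η x p K - x‖ ≤ L * (8 / 7 * (T * P)) := by
      gcongr; exact hpos' K le_rfl
    have hc : ‖∇ f (position f η x p K)‖ ≤ ‖∇ f x‖ + 8 / 7 * (L * T * P) := by linarith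
    have hS : 0 ≤ L * T * P := by positivity
    have hsq : ‖∇ f (position f η x p K)‖ ^ 2 ≤ (‖∇ f x‖ + 8 / 7 * (L * T * P)) ^ 2 := by gcongr
    have hm : ‖∇ f x‖ * (L * T * P) ≤ M * (L * T * P) := by gcongr
    have hm' : 0 ≤ M * (L * T * P) := by positivity
    nlinarith [sq_nonneg (L * T * P)]
  have h3 := mul_le_mul_of_nonneg_left h2 (by positivity : 0 ≤ η ^ 2 / 8)
  calc _ ≤ _ := h1
    _ ≤ η ^ 2 / 8 * (4 * (M * L * T * P + L ^ 2 * T ^ 2 * P ^ 2)) + K * (LH / 2 * (η * (2 * P)) ^ 3) := by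
      linarith
    _ = _ := by ring

end Energy

/-! ### The accept-reject step -/

section Accept

variable {d : ℕ} {f : State d → ℝ} {L LH η : ℝ} {K : ℕ}

theorem acceptProb_nonneg (x p : State d) : 0 ≤ acceptProb f K η x p := by
  unfold acceptProb; positivity

theorem one_sub_acceptProb_nonneg (x p : State d) : 0 ≤ 1 - acceptProb f K η x p :=
  sub_nonneg.mpr (min_le_left _ _)

theorem continuous_hamiltonian (hf : Continuous f) : Continuous (hamiltonian f) := by
  unfold hamiltonian
  fun_prop

theorem continuous_acceptProb (hf : Continuous f) (hg : Continuous (∇ f)) (x : State d) :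
    Continuous (acceptProb f K η x) := by
  have h1 := (continuous_hamiltonian hf).comp (continuous_endState (η := η) hg K x)
  have h2 : Continuous fun p => hamiltonian f (p, x) :=
    (continuous_hamiltonian hf).comp (by fun_prop)
  have h3 : Continuous fun p => hamiltonian f (endState f K η x p) := h1
  unfold acceptProb
  exact continuous_const.min ((Real.continuous_exp.comp h3.neg).div
    (Real.continuous_exp.comp h2.neg) fun p => (Real.exp_pos _).ne')

theorem one_sub_acceptProb_le {x p : State d} {r : ℝ} (hr : 0 ≤ r)
    (h : hamiltonian f (endState f K η x p) - hamiltonian f (p, x) ≤ r) :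
    1 - acceptProb f K η x p ≤ r := by
  unfold acceptProb
  rw [← Real.exp_sub, sub_le_comm, le_min_iff]
  refine ⟨by linarith, le_trans ?_ (Real.add_one_le_exp _)⟩
  linarith

theorem isProbabilityMeasure_transitionBeforeLazy (hf : Continuous f) (hg : Continuous (∇ f))
    (x : State d) : IsProbabilityMeasure (transitionBeforeLazy f K η x) := by
  have hα := (continuous_acceptProb (K := K) (η := η) hf hg x).measurable
  have hF : Measurable fun p => (endState f K η x p).2 :=
    (continuous_snd.comp (continuous_endState hg K x)).measurable
  refine ⟨?_⟩
  unfold transitionBeforeLazy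
  rw [Measure.add_apply, Measure.map_apply hF MeasurableSet.univ, Set.preimage_univ,
    withDensity_apply _ MeasurableSet.univ, Measure.restrict_univ,
    Measure.smul_apply, measure_univ, smul_eq_mul, mul_one,
    ← lintegral_add_left (by fun_prop)]
  have e : ∀ p, ENNReal.ofReal (acceptProb f K η x p) + ENNReal.ofReal (1 - acceptProb f K η x p)
      = 1 := fun p => by
    rw [← ENNReal.ofReal_add (acceptProb_nonneg x p) (one_sub_acceptProb_nonneg x p)]
    simp
  simp [e]

/-- The proposal and the Metropolized chain differ by at most the rejection probability, which
is controlled by the energy error for momenta of typical size `‖p‖ ≤ 4 √d`. -/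
theorem tvDist_proposal_transition_le (hf : Continuous f) (hg : Continuous (∇ f)) (hd : 1 ≤ d)
    (x : State d) (h : ∀ p : State d, ‖p‖ ^ 2 ≤ 16 * (d : ℝ) →
      hamiltonian f (endState f K η x p) - hamiltonian f (p, x) ≤ 1 / 16) :
    tvDist (proposal f K η x) (transitionBeforeLazy f K η x) ≤ 1 / 8 := by
  have := isProbabilityMeasure_proposal (K := K) (η := η) hg x
  have := isProbabilityMeasure_transitionBeforeLazy (K := K) (η := η) hf hg x
  have hα := (continuous_acceptProb (K := K) (η := η) hf hg x).measurable
  have hF : Measurable fun p => (endState f K η x p).2 :=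
    (continuous_snd.comp (continuous_endState hg K x)).measurable
  refine tvDist_le (by norm_num) fun A hA => ?_
  set γ := stdGaussian (State d) with hγ
  set S := (fun p => (endState f K η x p).2) ⁻¹' A with hS
  have hSm : MeasurableSet S := hF hA
  set bad : Set (State d) := {p | 16 * (d : ℝ) ≤ ‖p‖ ^ 2} with hbad
  have hbadm : MeasurableSet bad := measurableSet_le (by fun_prop) (by fun_prop)
  have hbadγ : γ bad ≤ ENNReal.ofReal (1 / 16) := by
    rw [← ofReal_measureReal]
    exact ENNReal.ofReal_le_ofReal (stdGaussian_norm_sq_ge_le hd)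
  have hpt : ∀ p, (1 : ℝ≥0∞) ≤ ENNReal.ofReal (acceptProb f K η x p)
      + (bad.indicator 1 p + ENNReal.ofReal (1 / 16)) := by
    intro p
    by_cases hp : p ∈ bad
    · rw [Set.indicator_of_mem hp, Pi.one_apply]
      exact le_add_left le_self_add
    · have h1 := one_sub_acceptProb_le (by norm_num) (h p (not_le.mp hp).le)
      rw [Set.indicator_of_notMem hp, zero_add,
        ← ENNReal.ofReal_add (acceptProb_nonneg x p) (by norm_num)]
      exact ENNReal.one_le_ofReal.mpr (by linarith)
  have hmain : proposal f K η x A ≤ transitionBeforeLazy f K η x A + ENNReal.ofReal (1 / 8) := by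
    calc proposal f K η x A = ∫⁻ _ in S, 1 ∂γ := by
          rw [proposal, Measure.map_apply hF hA]; simp [hS, hγ]
      _ ≤ ∫⁻ p in S, (ENNReal.ofReal (acceptProb f K η x p)
            + (bad.indicator 1 p + ENNReal.ofReal (1 / 16))) ∂γ := lintegral_mono hpt
      _ = ∫⁻ p in S, ENNReal.ofReal (acceptProb f K η x p) ∂γ
            + ∫⁻ p in S, (bad.indicator 1 p + ENNReal.ofReal (1 / 16)) ∂γ :=
          lintegral_add_left (by fun_prop) _
      _ ≤ transitionBeforeLazy f K η x A
            + ∫⁻ p, (bad.indicator 1 p + ENNReal.ofReal (1 / 16)) ∂γ := by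
          refine add_le_add ?_ (setLIntegral_le_lintegral _ _)
          rw [transitionBeforeLazy, Measure.add_apply, Measure.map_apply hF hA,
            withDensity_apply _ hSm]
          exact le_self_add
      _ = transitionBeforeLazy f K η x A + (γ bad + ENNReal.ofReal (1 / 16)) := by
          rw [lintegral_add_right _ measurable_const, lintegral_indicator_one hbadm]
          simp [hγ]
      _ ≤ transitionBeforeLazy f K η x A + (ENNReal.ofReal (1 / 16) + ENNReal.ofReal (1 / 16)) := by
          gcongr
      _ = _ := by
          rw [← ENNReal.ofReal_add (by norm_num) (by norm_num)]
          norm_num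
  have h2 := ENNReal.toReal_mono (by simp) hmain
  rw [ENNReal.toReal_add (by simp) (by simp), ENNReal.toReal_ofReal (by norm_num)] at h2
  rw [measureReal_def, measureReal_def]
  linarith

end Accept

/-! ### The step-size conditions -/

/-- A bound in `[0, ∞]` by a quotient, cleared of denominators.  The denominators may vanish, in
which case the bound carries no information and the conclusion is `0 ≤ N`. -/
theorem toReal_mul_le_of_le_one_div_mul {y A X N Z : ℝ≥0∞} (hN : N ≠ ∞)
    (h : y ≤ 1 / A * (1 / X * (N / Z))) :
    y.toReal * A.toReal * X.toReal * Z.toReal ≤ N.toReal := by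
  have clear : ∀ {a b t : ℝ≥0∞}, a ≤ 1 / b * t → a * b ≤ t := fun {a b t} h =>
    ENNReal.mul_le_of_le_div (by rwa [one_div, mul_comm, ← div_eq_mul_inv] at h)
  have h3 := ENNReal.toReal_mono hN (ENNReal.mul_le_of_le_div (clear (clear h)))
  rwa [ENNReal.toReal_mul, ENNReal.toReal_mul, ENNReal.toReal_mul] at h3

theorem toReal_mul_le_one_of_le_one_div {y A X : ℝ≥0∞} (h : y ≤ 1 / A * (1 / X)) :
    y.toReal * A.toReal * X.toReal ≤ 1 := by
  have := toReal_mul_le_of_le_one_div_mul (N := 1) (Z := 1) (by simp) (by simpa using h)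
  simpa using this

theorem rpow_div_three_pow_three {x : ℝ} (hx : 0 ≤ x) (n : ℕ) {r : ℝ} (hr : r * 3 = n) :
    (x ^ r) ^ 3 = x ^ n := by
  rw [← Real.rpow_natCast (x ^ r), ← Real.rpow_mul hx, ← Real.rpow_natCast x]
  rw [Nat.cast_ofNat, hr]

theorem mul_le_one_of_pow_mul_sq_le_one {c X : ℝ} {n : ℕ} (hc : 1 ≤ c) (hn : 2 ≤ n)
    (h : c ^ n * X ^ 2 ≤ 1) : c * X ≤ 1 := by
  have h1 : c ^ 2 * X ^ 2 ≤ c ^ n * X ^ 2 := by gcongr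
  rw [← mul_pow] at h1
  exact (le_abs_self _).trans ((sq_le_one_iff_abs_le_one _).mp (h1.trans h))

theorem mul_le_one_of_pow_mul_le_one {c X : ℝ} {n : ℕ} (hc : 1 ≤ c) (hn : 1 ≤ n) (hX : 0 ≤ X)
    (h : c ^ n * X ≤ 1) : c * X ≤ 1 := by
  have h1 : c ^ 1 * X ≤ c ^ n * X := by gcongr
  linarith [pow_one c]

/-- The six terms of the step-size threshold in polynomial form. -/
theorem stepThreshold_bounds {c L LH M η : ℝ} {d K : ℕ} (hc : 1 ≤ c) (hL : 0 < L) (hLH : 0 ≤ LH)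
    (hM : 0 ≤ M)
    (h : ENNReal.ofReal (η ^ 2) ≤ stepThreshold (ENNReal.ofReal c) (ENNReal.ofReal L)
      (ENNReal.ofReal LH) (ENNReal.ofReal M) d K) :
    c * (K ^ 2 * η ^ 2 * L) ≤ 1 ∧
    c * (η ^ 2 * L * K * √d) ≤ 1 ∧
    c * (η ^ 3 * K * L * M * √d) ≤ 1 ∧
    c * (K ^ 2 * η ^ 4 * L * M ^ 2) ≤ 1 ∧
    c * (η ^ 3 * K * √d ^ 3 * LH) ≤ 1 ∧
    c * (K ^ 4 * η ^ 6 * M ^ 3 * LH) ≤ 1 := by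
  have hc0 : 0 ≤ c := by linarith
  have hd0 : (0 : ℝ) ≤ d := by positivity
  have hK0 : (0 : ℝ) ≤ K := by positivity
  have hsd : √(d : ℝ) ^ 2 = d := Real.sq_sqrt hd0
  have hsL : √L ^ 2 = L := Real.sq_sqrt hL.le
  have hsL0 : 0 < √L := Real.sqrt_pos.mpr hL
  unfold stepThreshold at h
  simp only [ENNReal.div_rpow_of_nonneg _ _ (by norm_num : (0 : ℝ) ≤ 1 / 2),
    mul_min] at h
  simp only [le_min_iff] at h
  obtain ⟨h1, h2, h3, h4, h5, h6⟩ := h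
  replace h1 := toReal_mul_le_one_of_le_one_div h1
  replace h2 := toReal_mul_le_one_of_le_one_div h2
  replace h3 := toReal_mul_le_one_of_le_one_div h3
  replace h4 := toReal_mul_le_one_of_le_one_div h4
  replace h5 := toReal_mul_le_of_le_one_div_mul (by simp) h5
  replace h6 := toReal_mul_le_of_le_one_div_mul
    (ENNReal.rpow_ne_top_of_nonneg (by norm_num) (by simp)) h6
  simp only [ENNReal.toReal_mul, ENNReal.toReal_div, ← ENNReal.toReal_rpow, ENNReal.toReal_pow,
    ENNReal.toReal_natCast, ENNReal.toReal_ofReal hc0, ENNReal.toReal_ofReal hL.le,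
    ENNReal.toReal_ofReal hLH, ENNReal.toReal_ofReal hM, ENNReal.toReal_ofReal (sq_nonneg η),
    ← Real.sqrt_eq_rpow] at h1 h2 h3 h4 h5 h6
  have hK23 := rpow_div_three_pow_three hK0 2 (r := 2 / 3) (by norm_num)
  have hK43 := rpow_div_three_pow_three hK0 4 (r := 4 / 3) (by norm_num)
  have hd13 := rpow_div_three_pow_three hd0 1 (r := 1 / 3) (by norm_num)
  have hML := rpow_div_three_pow_three (by positivity : 0 ≤ M ^ 2 / L) 1 (r := 1 / 3) (by norm_num)
  have hLH23 := rpow_div_three_pow_three hLH 2 (r := 2 / 3) (by norm_num)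
  have hLH13 : √(LH ^ (2 / 3 : ℝ)) ^ 3 = LH := by
    rw [Real.sqrt_eq_rpow, ← Real.rpow_mul hLH,
      rpow_div_three_pow_three hLH 1 (by norm_num), pow_one]
  refine ⟨by linarith, by linarith, ?_, ?_, ?_, ?_⟩
  · refine mul_le_one_of_pow_mul_sq_le_one (n := 3) hc (by norm_num) ?_
    refine (pow_le_one₀ (n := 3) (by positivity) h3).trans' (le_of_eq ?_)
    simp only [mul_pow, hK23, hd13, hML, hsd]
    field_simp
  · refine mul_le_one_of_pow_mul_le_one (n := 2) hc (by norm_num) (by positivity) ?_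
    refine (pow_le_one₀ (n := 2) (by positivity) h4).trans' (le_of_eq ?_)
    simp only [mul_pow, div_pow, hsL]
    field_simp
  · refine mul_le_one_of_pow_mul_sq_le_one (n := 3) hc (by norm_num) ?_
    have h5' : η ^ 2 * c * (K ^ (2 / 3 : ℝ) * d) * LH ^ (2 / 3 : ℝ) ≤ 1 :=
      le_of_mul_le_mul_left (by linarith) hL
    refine (pow_le_one₀ (n := 3) (by positivity) h5').trans' (le_of_eq ?_)
    simp only [mul_pow, hK23, hLH23]
    rw [← hsd]
    simp only [Real.sqrt_sq (Real.sqrt_nonneg _)]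
    ring
  · refine mul_le_one_of_pow_mul_le_one (n := 3) hc (by norm_num) (by positivity) ?_
    have h6' : η ^ 2 * c * (K ^ (4 / 3 : ℝ) * M) * √(LH ^ (2 / 3 : ℝ)) ≤ 1 := by
      refine le_of_mul_le_mul_left (le_of_eq_of_le ?_ (h6.trans_eq (mul_one _).symm)) hsL0
      field_simp
      rw [hsL]
      ring
    refine (pow_le_one₀ (n := 3) (by positivity) h6').trans' (le_of_eq ?_)
    simp only [mul_pow, hK43, hLH13]
    ring

/-- The energy error over one trajectory is at most `1/16` once every term of the step-size
threshold holds with `c = 20000`; here `s = √d` and `P` bounds `‖p‖ + T M`. -/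
theorem energy_error_le {L LH M η s T P c K : ℝ} (hc : 20000 ≤ c) (hL : 0 ≤ L) (hLH : 0 ≤ LH)
    (hM : 0 ≤ M) (hη : 0 ≤ η) (hK : 0 ≤ K) (hs : 0 ≤ s) (hT : T = K * η) (hP : 0 ≤ P)
    (hPs : P ≤ 4 * s + T * M)
    (h1 : c * (K ^ 2 * η ^ 2 * L) ≤ 1)
    (h2 : c * (η ^ 2 * L * K * s) ≤ 1)
    (h3 : c * (η ^ 3 * K * L * M * s) ≤ 1)
    (h4 : c * (K ^ 2 * η ^ 4 * L * M ^ 2) ≤ 1)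
    (h5 : c * (η ^ 3 * K * s ^ 3 * LH) ≤ 1)
    (h6 : c * (K ^ 4 * η ^ 6 * M ^ 3 * LH) ≤ 1) :
    η ^ 2 / 2 * (M * L * T * P + L ^ 2 * T ^ 2 * P ^ 2) + 4 * K * LH * η ^ 3 * P ^ 3 ≤ 1 / 16 := by
  have hT0 : 0 ≤ T := by rw [hT]; positivity
  have hTM : 0 ≤ T * M := by positivity
  have red : ∀ {X : ℝ}, 0 ≤ X → c * X ≤ 1 → X ≤ 1 / 20000 := fun {X} hX h => by nlinarith
  have k1 := red (by positivity) h1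
  have k2 := red (by positivity) h2
  have k3 := red (by positivity) h3
  have k4 := red (by positivity) h4
  have k5 := red (by positivity) h5
  have k6 := red (by positivity) h6
  have hP2 : P ^ 2 ≤ 2 * (16 * s ^ 2 + (T * M) ^ 2) := by
    have : P ^ 2 ≤ (4 * s + T * M) ^ 2 := by gcongr
    nlinarith [sq_nonneg (4 * s - T * M)]
  have hP3 : P ^ 3 ≤ 4 * (64 * s ^ 3 + (T * M) ^ 3) := by
    have h : P ^ 3 ≤ (4 * s + T * M) ^ 3 := by gcongr
    have := mul_nonneg (by positivity : 0 ≤ 4 * s + T * M) (sq_nonneg (4 * s - T * M))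
    nlinarith
  have hA : η ^ 2 / 2 * (M * L * T * P)
      ≤ 2 * (η ^ 3 * K * L * M * s) + 1 / 2 * (K ^ 2 * η ^ 4 * L * M ^ 2) := by
    calc _ ≤ η ^ 2 / 2 * (M * L * T * (4 * s + T * M)) := by gcongr
      _ = _ := by rw [hT]; ring
  have hB : η ^ 2 / 2 * (L ^ 2 * T ^ 2 * P ^ 2)
      ≤ 16 * (η ^ 2 * L * K * s) ^ 2 + (K ^ 2 * η ^ 2 * L) * (K ^ 2 * η ^ 4 * L * M ^ 2) := by
    calc _ ≤ η ^ 2 / 2 * (L ^ 2 * T ^ 2 * (2 * (16 * s ^ 2 + (T * M) ^ 2))) := by gcongr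
      _ = _ := by rw [hT]; ring
  have hC : 4 * K * LH * η ^ 3 * P ^ 3
      ≤ 1024 * (η ^ 3 * K * s ^ 3 * LH) + 16 * (K ^ 4 * η ^ 6 * M ^ 3 * LH) := by
    calc _ ≤ 4 * K * LH * η ^ 3 * (4 * (64 * s ^ 3 + (T * M) ^ 3)) := by gcongr
      _ = _ := by rw [hT]; ring
  have hB1 : (η ^ 2 * L * K * s) ^ 2 ≤ (1 / 20000) ^ 2 := by gcongr
  have hB2 : (K ^ 2 * η ^ 2 * L) * (K ^ 2 * η ^ 4 * L * M ^ 2) ≤ 1 / 20000 * (1 / 20000) := by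
    gcongr
  norm_num at hB1 hB2
  rw [mul_add]
  linarith

/-- The bound on the total time `T`, split into a condition on `L` and one on `LH`. -/
theorem total_time_bounds {L LH T : ℝ} {d : ℕ} (hd : 1 ≤ d) (hL : 0 < L) (hLH : 0 ≤ LH)
    (h : T ^ 2 ≤ 1 / (4 * max ((d : ℝ) ^ (1 / 2 : ℝ) * L)
      ((d : ℝ) ^ (2 / 3 : ℝ) * LH ^ (2 / 3 : ℝ)))) :
    L * T ^ 2 ≤ 1 / 4 ∧ d * (LH * T ^ 3) ≤ 1 / 8 := by
  have hd1 : (1 : ℝ) ≤ d := by exact_mod_cast hd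
  have hd12 : 1 ≤ (d : ℝ) ^ (1 / 2 : ℝ) := Real.one_le_rpow hd1 (by norm_num)
  set m := max ((d : ℝ) ^ (1 / 2 : ℝ) * L) ((d : ℝ) ^ (2 / 3 : ℝ) * LH ^ (2 / 3 : ℝ)) with hm
  have hm1 : (d : ℝ) ^ (1 / 2 : ℝ) * L ≤ m := le_max_left _ _
  have hm2 : (d : ℝ) ^ (2 / 3 : ℝ) * LH ^ (2 / 3 : ℝ) ≤ m := le_max_right _ _
  have hLm : L ≤ m := (le_mul_of_one_le_left hL.le hd12).trans hm1
  rw [le_div_iff₀ (by linarith)] at h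
  refine ⟨?_, ?_⟩
  · have : T ^ 2 * L ≤ T ^ 2 * m := by gcongr
    linarith
  · have h2 : T ^ 2 * (4 * ((d : ℝ) ^ (2 / 3 : ℝ) * LH ^ (2 / 3 : ℝ))) ≤ 1 :=
      h.trans' (by gcongr)
    have h3 := pow_le_one₀ (n := 3) (by positivity) h2
    simp only [mul_pow, rpow_div_three_pow_three (by positivity : (0 : ℝ) ≤ d) 2
      (by norm_num : (2 / 3 : ℝ) * 3 = (2 : ℕ)), rpow_div_three_pow_three hLH 2
      (by norm_num : (2 / 3 : ℝ) * 3 = (2 : ℕ))] at h3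
    have h4 : (8 * (d * (LH * T ^ 3))) ^ 2 ≤ 1 := h3.trans' (le_of_eq (by ring))
    have h5 := (le_abs_self _).trans ((sq_le_one_iff_abs_le_one _).mp h4)
    linarith

end HMC

theorem lemma3 :
    ∃ c : ℝ, 0 < c ∧
      ∀ (d : ℕ) (f : HMC.State d → ℝ) (L LH s a ψ M : ℝ) (Ω : Set (HMC.State d))
        (K : ℕ) (η : ℝ),
        1 ≤ d → 0 < L → 0 ≤ LH → (a = 0 ∨ a = 1 / 2) → 0 < ψ → 0 ≤ M → 1 ≤ K → 0 < η →
        HMC.IsRegularOn f L LH s a ψ M Ω →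
        (K : ℝ) * η ≤ 1 / (4 * L) →
        (K : ℝ) ^ 2 * η ^ 2 ≤
          1 / (4 * max ((d : ℝ) ^ (1 / 2 : ℝ) * L)
            ((d : ℝ) ^ (2 / 3 : ℝ) * LH ^ (2 / 3 : ℝ))) →
        (∀ q₀ q₀' : HMC.State d, ‖q₀ - q₀'‖ ≤ K * η / 4 →
          HMC.tvDist (HMC.proposal f K η q₀) (HMC.proposal f K η q₀') ≤ 1 / 2) ∧
        (ENNReal.ofReal (η ^ 2) ≤
            HMC.stepThreshold (ENNReal.ofReal c) (ENNReal.ofReal L) (ENNReal.ofReal LH)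
              (ENNReal.ofReal M) d K →
          ∀ x ∈ Ω,
            HMC.tvDist (HMC.proposal f K η x) (HMC.transitionBeforeLazy f K η x) ≤ 1 / 8) := by
  refine ⟨20000, by norm_num, ?_⟩
  intro d f L LH s a ψ M Ω K η hd hL hLH _ _ hM hK hη hreg _ hT2
  have hη0 := hη.le
  rw [← mul_pow] at hT2
  obtain ⟨hLT, hLHT⟩ := HMC.total_time_bounds hd hL hLH hT2
  have hg := hreg.smooth.continuous_gradient hL.le
  refine ⟨fun q₀ q₀' hq => HMC.tvDist_proposal_le hreg.smooth hreg.hessianLipschitz hL.le hLH hd hη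
    hK rfl hLT hLHT hq, fun hstep x hx => ?_⟩
  refine HMC.tvDist_proposal_transition_le hreg.smooth.1.continuous hg hd x fun p hp => ?_
  obtain ⟨h1, h2, h3, h4, h5, h6⟩ := HMC.stepThreshold_bounds (by norm_num) hL hLH hM hstep
  refine (HMC.hamiltonian_endState_sub_le_of_gradient_le hreg.smooth hreg.hessianLipschitz hL.le hLH
    hη rfl hLT hM (hreg.gradient_le x hx)).trans ?_
  refine HMC.energy_error_le le_rfl hL.le hLH hM hη0 (Nat.cast_nonneg K) (Real.sqrt_nonneg d)
    rfl (by positivity) ?_ h1 h2 h3 h4 h5 h6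
  have : ‖p‖ ≤ √(16 * (d : ℝ)) := Real.le_sqrt_of_sq_le hp
  have e : √(16 * (d : ℝ)) = 4 * √d := by
    rw [Real.sqrt_mul (by norm_num), show (16 : ℝ) = 4 ^ 2 by norm_num,
      Real.sqrt_sq (by norm_num)]
  linarith
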